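/- Let $\Omega\subseteq\mathbb{R}^d$ be an experimental region and let $M_j=(h_j,\boldsymbol g_j,\boldsymbol\beta_j)$, $j=1,\dots,m$, be generalized linear models on $\Omega$ with link functions $h_j$, basis functions $\boldsymbol g_j:\Omega\to\mathbb{R}^{l_j}$ and coefficients $\boldsymbol\beta_j\in\mathbb{R}^{l_j}$: under $M_j$ the response $Y(\boldsymbol x)$ has a distribution in an exponential family, with mean $\mu_j(\boldsymbol x)=h_j^{-1}(\boldsymbol\beta_j^\top\boldsymbol g_j(\boldsymbol x))$ and finite positive variance, and $h_j$ is differentiable with nonzero derivative at $\mu_j(\boldsymbol x)$. Put $w_j(\boldsymbol x)=[\mathrm{Var}(Y(\boldsymbol x))\,h_j'(\mu_j(\boldsymbol x))^2]^{-1}$. A design $\xi$ on $\Omega$ is a probability measure with finitely many support points; for a design $\xi$ with weights $\lambda_i$ at points $\boldsymbol x_i$, let $\mathsf I_j(\xi)=\sum_i\lambda_i w_j(\boldsymbol x_i)\boldsymbol g_j(\boldsymbol x_i)\boldsymbol g_j(\boldsymbol x_i)^\top$. Let $\boldsymbol f_j:\mathbb{R}^{l_j}\to\mathbb{R}^{q_j}$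 be differentiable at $\boldsymbol\beta_j$ with Jacobian matrix $\mathsf B_j=\partial\boldsymbol f_j/\partial\boldsymbol\beta^\top$ at $\boldsymbol\beta_j$, and for designs with $\mathsf I_j(\xi)$ invertible put $\mathsf F_j(\xi)=\mathsf B_j\mathsf I_j(\xi)^{-1}\mathsf B_j^\top$ and $$\Phi_p^j(\xi)=\bigl(q_j^{-1}\operatorname{tr}\mathsf F_j(\xi)^p\bigr)^{1/p}\quad(0<p<\infty),$$ and, for the D-criterion $p=0$, either $\Phi_0^j(\xi)=\lim_{p\to0^+}\Phi_p^j(\xi)=(\det\mathsf F_j(\xi))^{1/q_j}$ or $\Phi_0^j(\xi)=\log\det\mathsf F_j(\xi)$ (the same choice for all $j$). Fix $p\ge 0$. For each $j$, let $\xi^{\mathrm{opt}}_j$ minimize $\Phi_p^j$ over all designs on $\Omega$ with $\mathsf I_j$ invertible, and suppose that $\Phi_p^j(\xi^{\mathrm{opt}}_j)>0$. Define $$\mathrm{se}(\xi)=\sum_{j=1}^m\exp\left(\frac{\Phi_p^j(\xi)}{\Phi_p^j(\xi^{\mathrm{opt}}_j)}\right),\qquad \mathrm{lse}(\xi)=\ln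 \mathrm{se}(\xi),$$ $$\phi(\boldsymbol x,\xi)=\lim_{\alpha\to0^+}\frac{\mathrm{se}((1-\alpha)\xi+\alpha\delta_{\boldsymbol x})-\mathrm{se}(\xi)}{\alpha},$$ where $\delta_{\boldsymbol x}$ is the design with unit mass at $\boldsymbol x$. Let $\boldsymbol x_1,\dots,\boldsymbol x_n\in\Omega$ be fixed, and for a weight vector $\boldsymbol\lambda$ (that is, $\lambda_i\ge0$ and $\sum_i\lambda_i=1$) let $\xi^{\boldsymbol\lambda}$ be the design with weight $\lambda_i$ at $\boldsymbol x_i$. Let $\Lambda$ be the set of the weight vectors for which all the matrices $\mathsf I_j(\xi^{\boldsymbol\lambda})$, $j=1,\dots,m$, are invertible, and let $\boldsymbol\lambda^*\in\Lambda$. Then the limits $\phi(\boldsymbol x_i,\xi^{\boldsymbol\lambda^*})$, $i=1,\dots,n$, exist, and the following are equivalent: 1. $\boldsymbol\lambda^*$ minimizes $\mathrm{se}(\xi^{\boldsymbol\lambda})$ over $\boldsymbol\lambda\in\Lambda$; 2. $\boldsymbol\lambda^*$ minimizes $\mathrm{lse}(\xi^{\boldsymbol\lambda})$ over $\boldsymbol\lambda\in\Lambda$;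 3. $\phi(\boldsymbol x_i,\xi^{\boldsymbol\lambda^*})=0$ for all $i$ with $\lambda_i^*>0$, and $\phi(\boldsymbol x_i,\xi^{\boldsymbol\lambda^*})\ge0$ for all $i$ with $\lambda_i^*=0$. -/

import Mathlib

open Filter Topology MeasureTheory Matrix

noncomputable section

namespace MmPhi

/-- An exponential family of distributions on `ℝ`: a base measure and a vector of sufficient
statistics. -/
structure ExpFamily where
  dim : ℕ
  base : Measure ℝ
  base_ne_zero : base ≠ 0
  stat : ℝ → Fin dim → ℝ
  measurable_stat : Measurable stat

/-- The natural parameter space: the parameters at which the density can be normalized. -/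
def ExpFamily.naturalSpace (E : ExpFamily) : Set (Fin E.dim → ℝ) :=
  {θ | Integrable (fun y => Real.exp (θ ⬝ᵥ E.stat y)) E.base}

/-- The member with natural parameter `θ`: the probability measure whose density with respect to
the base measure is proportional to `exp (θ ⬝ T(y))`. -/
def ExpFamily.law (E : ExpFamily) (θ : Fin E.dim → ℝ) : Measure ℝ :=
  E.base.tilted (fun y => θ ⬝ᵥ E.stat y)

/-- A generalized linear model specification on the experimental region `Ω ⊆ ℝ^d`: a link `h`
(a bijection from the set of possible means onto the set of possible linear predictors), basis
functions `g = (g_1, …, g_l)`, coefficients `β`, and a response whose law at `x` is a member of an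
exponential family and has mean `h⁻¹(βᵀ g(x))`. The last four fields say that the weight
`[Var(Y(x)) (h'(μ(x)))²]⁻¹` is meaningful. -/
structure GLM {d : ℕ} (Ω : Set (Fin d → ℝ)) where
  numBasis : ℕ
  link : PartialEquiv ℝ ℝ
  basis : (Fin d → ℝ) → Fin numBasis → ℝ
  coef : Fin numBasis → ℝ
  family : ExpFamily
  natParam : (Fin d → ℝ) → Fin family.dim → ℝ
  natParam_mem : ∀ x ∈ Ω, natParam x ∈ family.naturalSpace
  predictor_mem : ∀ x ∈ Ω, coef ⬝ᵥ basis x ∈ link.target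
  mean_eq : ∀ x ∈ Ω, ∫ y, y ∂(family.law (natParam x)) = link.symm (coef ⬝ᵥ basis x)
  memLp_response : ∀ x ∈ Ω, MemLp id 2 (family.law (natParam x))
  variance_pos : ∀ x ∈ Ω, 0 < ProbabilityTheory.variance id (family.law (natParam x))
  differentiableAt_link : ∀ x ∈ Ω, DifferentiableAt ℝ link (link.symm (coef ⬝ᵥ basis x))
  deriv_link_ne_zero : ∀ x ∈ Ω, deriv link (link.symm (coef ⬝ᵥ basis x)) ≠ 0

variable {d : ℕ} {Ω : Set (Fin d → ℝ)}

/-- The mean response `μ(x) = h⁻¹(βᵀ g(x))`. -/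
def GLM.mean (M : GLM Ω) (x : Fin d → ℝ) : ℝ :=
  M.link.symm (M.coef ⬝ᵥ M.basis x)

/-- The variance of the response at `x`. -/
def GLM.responseVar (M : GLM Ω) (x : Fin d → ℝ) : ℝ :=
  ProbabilityTheory.variance id (M.family.law (M.natParam x))

/-- The weight `w(x, M) = [Var(Y(x)) (h'(μ(x)))²]⁻¹`. -/
def GLM.weight (M : GLM Ω) (x : Fin d → ℝ) : ℝ :=
  (M.responseVar x * (deriv M.link (M.mean x)) ^ 2)⁻¹

/-- `ξ` is an approximate design on `Ω`: a probability vector on finitely many points of `Ω`. -/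
def IsDesign (Ω : Set (Fin d → ℝ)) (ξ : (Fin d → ℝ) →₀ ℝ) : Prop :=
  (∀ x, 0 ≤ ξ x) ∧ (ξ.sum fun _ a => a) = 1 ∧ (↑ξ.support : Set (Fin d → ℝ)) ⊆ Ω

/-- The design `ξ^λ` with points `x_1, …, x_n` and weights `λ_1, …, λ_n`. -/
def designOf {n : ℕ} (x : Fin n → Fin d → ℝ) (lam : Fin n → ℝ) : (Fin d → ℝ) →₀ ℝ :=
  ∑ i, Finsupp.single (x i) (lam i)

/-- The Fisher information matrix `I(ξ, M) = ∑ λ_i w(x_i, M) g(x_i) g(x_i)ᵀ`. -/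
def GLM.info (M : GLM Ω) (ξ : (Fin d → ℝ) →₀ ℝ) :
    Matrix (Fin M.numBasis) (Fin M.numBasis) ℝ :=
  ξ.sum fun x a => (a * M.weight x) • vecMulVec (M.basis x) (M.basis x)

/-- The information matrix is invertible, so that the design criteria below are meaningful. -/
def GLM.Nonsingular (M : GLM Ω) (ξ : (Fin d → ℝ) →₀ ℝ) : Prop :=
  IsUnit (M.info ξ).det

/-- The Jacobian matrix `∂f(β)/∂βᵀ`. -/
def jacobian {l q : ℕ} (f : (Fin l → ℝ) → Fin q → ℝ) (β : Fin l → ℝ) :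
    Matrix (Fin q) (Fin l) ℝ :=
  Matrix.of fun i k => fderiv ℝ f β (Pi.single k 1) i

/-- The matrix `F(ξ) = B I(ξ)⁻¹ Bᵀ` with `B` the Jacobian of `f` at the model coefficients. -/
def GLM.covar (M : GLM Ω) {q : ℕ} (f : (Fin M.numBasis → ℝ) → Fin q → ℝ)
    (ξ : (Fin d → ℝ) →₀ ℝ) : Matrix (Fin q) (Fin q) ℝ :=
  jacobian f M.coef * (M.info ξ)⁻¹ * (jacobian f M.coef)ᵀ

/-- The index of the local criterion: a power `p > 0`, or one of the two customary forms of the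
D-criterion `p = 0`. -/
inductive Criterion where
  | power (p : ℝ) (hp : 0 < p)
  | detRoot
  | logDet

/-- The criterion as a function of the matrix `F`:
`((1/q) tr F^p)^(1/p)` for `p > 0`; its limit `(det F)^(1/q)` as `p → 0`; and `log (det F)`.
The real power `F^p` of the positive semidefinite `F` is taken by functional calculus. -/
def Criterion.value {q : ℕ} (c : Criterion) (F : Matrix (Fin q) (Fin q) ℝ) : ℝ :=
  match c with
  | .power p _ => ((q : ℝ)⁻¹ * (cfc (fun t : ℝ => t ^ p) F).trace) ^ (1 / p)
  | .detRoot => F.det ^ (1 / (q : ℝ))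
  | .logDet => Real.log F.det

/-- The local criterion `Φ_p(ξ, M)`. -/
def GLM.Phi (M : GLM Ω) (c : Criterion) {q : ℕ} (f : (Fin M.numBasis → ℝ) → Fin q → ℝ)
    (ξ : (Fin d → ℝ) →₀ ℝ) : ℝ :=
  c.value (M.covar f ξ)

/-- `ξ` is a local optimal design for `M`: it minimizes `Φ_p(·, M)` over the designs on `Ω`. -/
def GLM.IsLocalOptimal (M : GLM Ω) (c : Criterion) {q : ℕ}
    (f : (Fin M.numBasis → ℝ) → Fin q → ℝ) (ξ : (Fin d → ℝ) →₀ ℝ) : Prop :=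
  (IsDesign Ω ξ ∧ M.Nonsingular ξ) ∧
    ∀ ξ', IsDesign Ω ξ' → M.Nonsingular ξ' → M.Phi c f ξ ≤ M.Phi c f ξ'

/-- The efficiency `Φ_p(ξ', M) / Φ_p(ξ, M)` of `ξ` relative to `ξ'`. -/
def GLM.eff (M : GLM Ω) (c : Criterion) {q : ℕ} (f : (Fin M.numBasis → ℝ) → Fin q → ℝ)
    (ξ ξ' : (Fin d → ℝ) →₀ ℝ) : ℝ :=
  M.Phi c f ξ' / M.Phi c f ξ

section Criteria

variable {m : ℕ} (c : Criterion) (M : Fin m → GLM Ω) {q : Fin m → ℕ}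
  (f : ∀ j, (Fin (M j).numBasis → ℝ) → Fin (q j) → ℝ) (ξopt : Fin m → (Fin d → ℝ) →₀ ℝ)

/-- `se(ξ, M') = ∑ⱼ exp (1 / eff(ξ, ξopt_j; M_j))`. -/
def se (ξ : (Fin d → ℝ) →₀ ℝ) : ℝ :=
  ∑ j, Real.exp (1 / (M j).eff c (f j) ξ (ξopt j))

/-- `lse(ξ, M') = log (∑ⱼ exp (1 / eff(ξ, ξopt_j; M_j)))`. -/
def lse (ξ : (Fin d → ℝ) →₀ ℝ) : ℝ :=
  Real.log (∑ j, Real.exp (1 / (M j).eff c (f j) ξ (ξopt j)))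

/-- The difference quotient of `se` at `ξ` in the direction of `ξ'`. -/
def seQuotient (ξ' ξ : (Fin d → ℝ) →₀ ℝ) (α : ℝ) : ℝ :=
  (se c M f ξopt ((1 - α) • ξ + α • ξ') - se c M f ξopt ξ) / α

/-- The directional derivative `φ(ξ', ξ)` of `se` at `ξ` in the direction of `ξ'`, the limit of
the difference quotients as `α → 0+`. -/
def dirDeriv (ξ' ξ : (Fin d → ℝ) →₀ ℝ) : ℝ :=
  limUnder (𝓝[>] (0 : ℝ)) (seQuotient c M f ξopt ξ' ξ)

/-- `φ(x, ξ)`: the directional derivative in the direction of the unit mass at `x`. -/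
def pointDirDeriv (x : Fin d → ℝ) (ξ : (Fin d → ℝ) →₀ ℝ) : ℝ :=
  dirDeriv c M f ξopt (Finsupp.single x 1) ξ

end Criteria

/-- The admissible weight vectors for the points `x_1, …, x_n`: those in the closed probability
simplex for which all the information matrices are invertible. -/
def weightDomain {m n : ℕ} (M : Fin m → GLM Ω) (x : Fin n → Fin d → ℝ) : Set (Fin n → ℝ) :=
  {lam | lam ∈ stdSimplex ℝ (Fin n) ∧ ∀ j, (M j).Nonsingular (designOf x lam)}

end MmPhi

end

/-! The information matrix `A` is linear in the weights, and each criterion is convex in `A`, so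
everything reduces to a convex differentiable function on a simplex. The delicate point is
differentiability: `F = B A⁻¹ Bᵀ` may be singular, where `tr F ^ p` need not be smooth in `F`. What
saves it is that `ker F = ker Bᵀ` does not depend on `A`.

Convexity and differentiability are obtained together by squeezing each criterion near `A₀` between
two functions touching it there. Let `u_k`, `t_k` be the eigenpairs of `F` at `A₀`, and `v_i`, `s_i`
those at `A`. The squared overlaps `(v_i ⬝ u_k)²` form a doubly stochastic matrix. Below: for `t_k >
0` fix `z_k` with `B z_k = u_k`; then `∑ i, (v_i ⬝ u_k)² / s_i ≤ z_kᵀ A z_k`, and convexity in the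
reciprocal eigenvalues gives an affine minorant (`exists_affine_lower`). Above: Jensen bounds `tr F
^ p` by `∑ (u_kᵀ F ^ N u_k) ^ (p / N)` over `t_k > 0`, which is differentiable for an integer `N ≥
p`; determinants are differentiable outright (`exists_upper`).

Composition with `exp` preserves tangent bounds, so `se` has a derivative `L` at `λ*` and lies above
its tangent (`exists_hasFDerivAt_se`). Then `φ(x_i) = L (e_i - λ*)` and `L (ν - λ*) = ∑ ν_i φ(x_i)`,
from which the optimality conditions follow. -/

namespace MmPhi

/-! ### Eigenvectors of `B A⁻¹ Bᵀ` and their overlaps. -/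

section Spectral

variable {ι κ : Type*} [Fintype ι] [DecidableEq ι] [Fintype κ] [DecidableEq κ]

lemma exists_spectral {F : Matrix ι ι ℝ} (hF : F.PosSemidef) :
    ∃ (V : Matrix ι ι ℝ) (s : ι → ℝ), V * Vᵀ = 1 ∧ Vᵀ * V = 1 ∧ (∀ i, 0 ≤ s i) ∧
      F = V * diagonal s * Vᵀ ∧ F.det = ∏ i, s i ∧
      ∀ p : ℝ, (cfc (fun t : ℝ => t ^ p) F).trace = ∑ i, s i ^ p := by
  have hH : F.IsHermitian := hF.1
  have hU1 : (hH.eigenvectorUnitary : Matrix ι ι ℝ) *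
      (hH.eigenvectorUnitary : Matrix ι ι ℝ)ᵀ = 1 := by
    have := Unitary.coe_mul_star_self hH.eigenvectorUnitary
    rwa [Unitary.coe_star, star_eq_conjTranspose, conjTranspose_eq_transpose_of_trivial] at this
  have hU2 : (hH.eigenvectorUnitary : Matrix ι ι ℝ)ᵀ *
      (hH.eigenvectorUnitary : Matrix ι ι ℝ) = 1 := by
    have := Unitary.coe_star_mul_self hH.eigenvectorUnitary
    rwa [star_eq_conjTranspose, conjTranspose_eq_transpose_of_trivial] at this
  refine ⟨hH.eigenvectorUnitary, hH.eigenvalues, hU1, hU2, hF.eigenvalues_nonneg, ?_, ?_, ?_⟩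
  · have := hH.spectral_theorem
    rw [Unitary.conjStarAlgAut_apply, star_eq_conjTranspose,
      conjTranspose_eq_transpose_of_trivial] at this
    exact this
  · simpa using hH.det_eq_prod_eigenvalues
  · intro p
    rw [hH.cfc_eq, Matrix.IsHermitian.cfc, Unitary.conjStarAlgAut_apply, star_eq_conjTranspose,
      conjTranspose_eq_transpose_of_trivial, trace_mul_cycle, hU2, one_mul, trace_diagonal]
    rfl

lemma sum_sq_row_eq_one {W : Matrix ι ι ℝ} (h : W * Wᵀ = 1) (i : ι) : ∑ k, W i k ^ 2 = 1 := by
  have := congrFun (congrFun h i) i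
  simpa [Matrix.mul_apply, sq] using this

lemma sum_sq_col_eq_one {W : Matrix ι ι ℝ} (h : Wᵀ * W = 1) (k : ι) : ∑ i, W i k ^ 2 = 1 := by
  have := congrFun (congrFun h k) k
  simpa [Matrix.mul_apply, sq] using this

lemma dotProduct_spectral (V : Matrix ι ι ℝ) (s u : ι → ℝ) :
    u ⬝ᵥ (V * diagonal s * Vᵀ) *ᵥ u = ∑ i, s i * (Vᵀ *ᵥ u) i ^ 2 := by
  rw [← mulVec_mulVec, ← mulVec_mulVec, dotProduct_mulVec, ← mulVec_transpose]
  simp only [dotProduct, mulVec_diagonal]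
  exact Finset.sum_congr rfl fun i _ => by ring

-- Expand `(z - v)ᵀ A (z - v) ≥ 0` at `v = A⁻¹ Bᵀ w`. For fixed `z` the last term is linear in `A`,
-- which is the source of all affine minorants.
omit [DecidableEq ι] in
lemma two_mul_dotProduct_le {A : Matrix κ κ ℝ} (hA : A.PosDef) (B : Matrix ι κ ℝ) (z : κ → ℝ)
    (w : ι → ℝ) :
    2 * (w ⬝ᵥ B *ᵥ z) ≤ w ⬝ᵥ (B * A⁻¹ * Bᵀ) *ᵥ w + z ⬝ᵥ A *ᵥ z := by
  set v := A⁻¹ *ᵥ (Bᵀ *ᵥ w) with hv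
  have hdet : IsUnit A.det := hA.det_pos.ne'.isUnit
  have hAv : A *ᵥ v = Bᵀ *ᵥ w := by
    rw [hv, mulVec_mulVec, mul_nonsing_inv _ hdet, one_mulVec]
  have h0 := hA.posSemidef.dotProduct_mulVec_nonneg (z - v)
  rw [star_trivial, mulVec_sub, dotProduct_sub, sub_dotProduct, sub_dotProduct, hAv] at h0
  have hAT : Aᵀ = A := by
    rw [← conjTranspose_eq_transpose_of_trivial]; exact hA.1
  have h1 : v ⬝ᵥ A *ᵥ z = z ⬝ᵥ Bᵀ *ᵥ w := by
    rw [← hAv, dotProduct_mulVec, ← mulVec_transpose, hAT, dotProduct_comm]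
  have h2 : z ⬝ᵥ Bᵀ *ᵥ w = w ⬝ᵥ B *ᵥ z := by
    rw [dotProduct_mulVec, vecMul_transpose, dotProduct_comm]
  have h3 : v ⬝ᵥ Bᵀ *ᵥ w = w ⬝ᵥ (B * A⁻¹ * Bᵀ) *ᵥ w := by
    rw [dotProduct_mulVec, vecMul_transpose, dotProduct_comm, hv, mulVec_mulVec, mulVec_mulVec,
      Matrix.mul_assoc]
  rw [h1, h2, h3] at h0
  linarith

lemma two_mul_sum_le {A : Matrix κ κ ℝ} (hA : A.PosDef) {B : Matrix ι κ ℝ} {V : Matrix ι ι ℝ}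
    {s : ι → ℝ} (hV : Vᵀ * V = 1) (hF : B * A⁻¹ * Bᵀ = V * diagonal s * Vᵀ) (z : κ → ℝ)
    (y : ι → ℝ) :
    2 * ∑ i, y i * (Vᵀ *ᵥ (B *ᵥ z)) i ≤ ∑ i, s i * y i ^ 2 + z ⬝ᵥ A *ᵥ z := by
  have h := two_mul_dotProduct_le hA B z (V *ᵥ y)
  rw [hF, dotProduct_spectral, mulVec_mulVec, hV, one_mulVec] at h
  have h2 : (V *ᵥ y) ⬝ᵥ B *ᵥ z = ∑ i, y i * (Vᵀ *ᵥ (B *ᵥ z)) i := by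
    rw [← vecMul_transpose, ← dotProduct_mulVec]; rfl
  rwa [h2] at h

/-- Along a null eigenvector the quadratic term of `two_mul_sum_le` vanishes, so the linear term,
being bounded, must vanish too. -/
lemma overlap_eq_zero {A : Matrix κ κ ℝ} (hA : A.PosDef) {B : Matrix ι κ ℝ} {V : Matrix ι ι ℝ}
    {s : ι → ℝ} (hV : Vᵀ * V = 1) (hF : B * A⁻¹ * Bᵀ = V * diagonal s * Vᵀ) (z : κ → ℝ)
    {i : ι} (hi : s i = 0) : (Vᵀ *ᵥ (B *ᵥ z)) i = 0 := by
  by_contra hne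
  -- The coefficient makes the left side equal to `zᵀ A z + 1`.
  have h := two_mul_sum_le hA hV hF z
    (Pi.single i ((z ⬝ᵥ A *ᵥ z + 1) / (2 * (Vᵀ *ᵥ (B *ᵥ z)) i)))
  rw [Finset.sum_eq_single i (fun j _ hj => by simp [hj]) (by simp),
    Finset.sum_eq_single i (fun j _ hj => by simp [hj]) (by simp), Pi.single_eq_same, hi] at h
  have e : 2 * ((z ⬝ᵥ A *ᵥ z + 1) / (2 * (Vᵀ *ᵥ (B *ᵥ z)) i) * (Vᵀ *ᵥ (B *ᵥ z)) i)
      = z ⬝ᵥ A *ᵥ z + 1 := by field_simp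
  rw [e] at h
  linarith

/-- Optimize `two_mul_sum_le` over `y`. Where `s i = 0` the convention `0⁻¹ = 0` drops a term whose
overlap is zero anyway. -/
lemma sum_inv_overlap_le {A : Matrix κ κ ℝ} (hA : A.PosDef) {B : Matrix ι κ ℝ} {V : Matrix ι ι ℝ}
    {s : ι → ℝ} (hV : Vᵀ * V = 1) (hF : B * A⁻¹ * Bᵀ = V * diagonal s * Vᵀ) (z : κ → ℝ) :
    ∑ i, (s i)⁻¹ * (Vᵀ *ᵥ (B *ᵥ z)) i ^ 2 ≤ z ⬝ᵥ A *ᵥ z := by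
  have h := two_mul_sum_le hA hV hF z (fun i => (s i)⁻¹ * (Vᵀ *ᵥ (B *ᵥ z)) i)
  have e1 : ∑ i, (s i)⁻¹ * (Vᵀ *ᵥ (B *ᵥ z)) i * (Vᵀ *ᵥ (B *ᵥ z)) i
      = ∑ i, (s i)⁻¹ * (Vᵀ *ᵥ (B *ᵥ z)) i ^ 2 := Finset.sum_congr rfl fun i _ => by ring
  have e2 : ∑ i, s i * ((s i)⁻¹ * (Vᵀ *ᵥ (B *ᵥ z)) i) ^ 2
      = ∑ i, (s i)⁻¹ * (Vᵀ *ᵥ (B *ᵥ z)) i ^ 2 := by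
    refine Finset.sum_congr rfl fun i _ => ?_
    by_cases hi : s i = 0
    · simp [hi]
    · field_simp
  rw [e1, e2] at h
  linarith

/-- For an eigenvector `u` of `B A⁻¹ Bᵀ` with eigenvalue `t`, the minimizer of `zᵀ A z` under the
constraint `B z = u`. -/
noncomputable def dualVec (A : Matrix κ κ ℝ) (B : Matrix ι κ ℝ) (u : ι → ℝ) (t : ℝ) : κ → ℝ :=
  t⁻¹ • A⁻¹ *ᵥ (Bᵀ *ᵥ u)

omit [DecidableEq ι] in
lemma mulVec_dualVec {A : Matrix κ κ ℝ} {B : Matrix ι κ ℝ} {u : ι → ℝ} {t : ℝ} (ht : t ≠ 0)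
    (hu : (B * A⁻¹ * Bᵀ) *ᵥ u = t • u) : B *ᵥ dualVec A B u t = u := by
  rw [dualVec, mulVec_smul, mulVec_mulVec, mulVec_mulVec, hu, smul_smul,
    inv_mul_cancel₀ ht, one_smul]

omit [DecidableEq ι] in
lemma dotProduct_dualVec {A : Matrix κ κ ℝ} (hA : A.PosDef) {B : Matrix ι κ ℝ} {u : ι → ℝ} {t : ℝ}
    (ht : t ≠ 0) (hu : (B * A⁻¹ * Bᵀ) *ᵥ u = t • u) (hn : u ⬝ᵥ u = 1) :
    t * (dualVec A B u t ⬝ᵥ A *ᵥ dualVec A B u t) = 1 := by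
  have hdet : IsUnit A.det := hA.det_pos.ne'.isUnit
  have h1 : A *ᵥ dualVec A B u t = t⁻¹ • (Bᵀ *ᵥ u) := by
    rw [dualVec, mulVec_smul, mulVec_mulVec, mul_nonsing_inv _ hdet, one_mulVec]
  rw [h1, dotProduct_smul, dotProduct_mulVec, vecMul_transpose, mulVec_dualVec ht hu, hn]
  simp [ht]

lemma spectral_mulVec_col {U : Matrix ι ι ℝ} {t : ι → ℝ} (hU : Uᵀ * U = 1) (k : ι) :
    (U * diagonal t * Uᵀ) *ᵥ (Uᵀ k) = t k • Uᵀ k := by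
  have h : Uᵀ *ᵥ (Uᵀ k) = Pi.single k 1 := by
    ext i
    have := congrFun (congrFun hU i) k
    rw [Matrix.mul_apply] at this
    simp only [mulVec, dotProduct, transpose_apply] at this ⊢
    rw [this, Matrix.one_apply, Pi.single_apply]
  rw [← mulVec_mulVec, ← mulVec_mulVec, h, diagonal_mulVec_single, mul_one]
  ext i
  simp [mul_comm]

lemma col_dotProduct_self {U : Matrix ι ι ℝ} (hU : Uᵀ * U = 1) (k : ι) : Uᵀ k ⬝ᵥ Uᵀ k = 1 := by
  have := congrFun (congrFun hU k) k
  simpa [Matrix.mul_apply, dotProduct] using this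

omit [DecidableEq ι] [Fintype κ] [DecidableEq κ] in
lemma mulVec_col_eq_mul (V U : Matrix ι ι ℝ) (i k : ι) : (Vᵀ *ᵥ Uᵀ k) i = (Vᵀ * U) i k := rfl

end Spectral

/-! ### Inequalities for eigenvalues under doubly stochastic averaging. -/

section Scalar

variable {ι : Type*} [Fintype ι]

/-- This is the tangent to `x ^ (-p)` at `x = 1`, taken at `x = r * t / s`. The free scale `r` is
optimized later. -/
lemma rpow_tangent_le {p s t r : ℝ} (hp : 0 < p) (hs : 0 < s) (ht : 0 < t) (hr : 0 < r) :
    r ^ p * (t ^ p * (1 + p * (1 - r * (t * s⁻¹)))) ≤ s ^ p := by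
  set x := r * (t * s⁻¹) with hx
  have hxpos : 0 < x := by positivity
  have h1 : s ^ p * x ^ p = r ^ p * t ^ p := by
    rw [← Real.mul_rpow hs.le hxpos.le, ← Real.mul_rpow hr.le ht.le]
    congr 1; rw [hx]; field_simp
  have h2 : 1 + p * (1 - x) ≤ (x ^ p)⁻¹ := by
    rw [← Real.rpow_neg hxpos.le, Real.rpow_def_of_pos hxpos]
    have := Real.add_one_le_exp (Real.log x * -p)
    have hl := Real.log_le_sub_one_of_pos hxpos
    nlinarith
  have hxp : 0 < x ^ p := Real.rpow_pos_of_pos hxpos p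
  calc r ^ p * (t ^ p * (1 + p * (1 - x))) = s ^ p * x ^ p * (1 + p * (1 - x)) := by
        rw [h1]; ring
    _ ≤ s ^ p * x ^ p * (x ^ p)⁻¹ := by
        apply mul_le_mul_of_nonneg_left h2; positivity
    _ = s ^ p := by field_simp

/-- Two families of eigenvalues `s`, `t` with squared overlaps `W i k ^ 2`, and upper bounds `a` of
the averaged reciprocals. -/
structure Overlap (s t a : ι → ℝ) (W : ι → ι → ℝ) : Prop where
  s_nonneg : ∀ i, 0 ≤ s i
  t_nonneg : ∀ k, 0 ≤ t k
  row : ∀ i, ∑ k, W i k ^ 2 = 1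
  col : ∀ k, ∑ i, W i k ^ 2 = 1
  eq_zero : ∀ i k, 0 < t k → s i = 0 → W i k = 0
  sum_inv_le : ∀ k, 0 < t k → ∑ i, (s i)⁻¹ * W i k ^ 2 ≤ a k

variable {s t a : ι → ℝ} {W : ι → ι → ℝ}

lemma Overlap.pos_of_pos (h : Overlap s t a W) {k : ι} (hk : 0 < t k) : 0 < a k := by
  refine lt_of_lt_of_le ?_ (h.sum_inv_le k hk)
  have hnn : ∀ i ∈ Finset.univ, 0 ≤ (s i)⁻¹ * W i k ^ 2 := fun i _ =>
    mul_nonneg (inv_nonneg.2 (h.s_nonneg i)) (sq_nonneg _)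
  refine lt_of_le_of_ne (Finset.sum_nonneg hnn) fun h0 => ?_
  have hz := (Finset.sum_eq_zero_iff_of_nonneg hnn).1 h0.symm
  have : ∑ i, W i k ^ 2 = 0 := Finset.sum_eq_zero fun i _ => by
    rcases mul_eq_zero.1 (hz i (Finset.mem_univ i)) with h1 | h1
    · rw [h.eq_zero i k hk (inv_eq_zero.1 h1)]; simp
    · exact h1
  rw [h.col k] at this
  exact one_ne_zero this

/-- Average `rpow_tangent_le` with weights `W i k ^ 2`: unit row sums rebuild `∑ s i ^ p`, unit
column sums the right constants. -/
lemma Overlap.sum_rpow_ge (h : Overlap s t a W) {p r : ℝ} (hp : 0 < p) (hr : 0 < r) :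
    r ^ p * ∑ k, t k ^ p * (1 + p * (1 - r * (t k * a k))) ≤ ∑ i, s i ^ p := by
  have hrp : 0 < r ^ p := Real.rpow_pos_of_pos hr p
  have e1 : ∑ i, s i ^ p = ∑ k, ∑ i, s i ^ p * W i k ^ 2 := by
    rw [Finset.sum_comm]
    exact Finset.sum_congr rfl fun i _ => by rw [← Finset.mul_sum, h.row i, mul_one]
  rw [e1, Finset.mul_sum]
  refine Finset.sum_le_sum fun k _ => ?_
  rcases (h.t_nonneg k).eq_or_lt with h0 | hk
  · rw [← h0, Real.zero_rpow hp.ne', zero_mul, mul_zero]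
    exact Finset.sum_nonneg fun i _ =>
      mul_nonneg (Real.rpow_nonneg (h.s_nonneg i) p) (sq_nonneg _)
  have htp : 0 < t k ^ p := Real.rpow_pos_of_pos hk p
  calc r ^ p * (t k ^ p * (1 + p * (1 - r * (t k * a k))))
      ≤ r ^ p * (t k ^ p * (1 + p * (1 - r * (t k * ∑ i, (s i)⁻¹ * W i k ^ 2)))) := by
        have := h.sum_inv_le k hk
        gcongr
    _ = ∑ i, r ^ p * (t k ^ p * (1 + p * (1 - r * (t k * (s i)⁻¹)))) * W i k ^ 2 := by
        have e2 : ∀ i, r ^ p * (t k ^ p * (1 + p * (1 - r * (t k * (s i)⁻¹)))) * W i k ^ 2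
            = r ^ p * (t k ^ p * (1 + p)) * W i k ^ 2
              - r ^ p * (t k ^ p * (p * (r * t k))) * ((s i)⁻¹ * W i k ^ 2) := fun i => by ring
        simp_rw [e2]
        rw [Finset.sum_sub_distrib, ← Finset.mul_sum, ← Finset.mul_sum, h.col k]
        ring
    _ ≤ ∑ i, s i ^ p * W i k ^ 2 := by
        refine Finset.sum_le_sum fun i _ => ?_
        rcases (h.s_nonneg i).eq_or_lt with hs | hs
        · rw [h.eq_zero i k hk hs.symm]; simp
        · exact mul_le_mul_of_nonneg_right (rpow_tangent_le hp hs hk hr) (sq_nonneg _)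

/-- The power mean of `s` lies above an affine function of `a`. -/
lemma Overlap.powerMean_ge (h : Overlap s t a W) {p : ℝ} (hp : 0 < p) {c : ℝ} (hc : 0 ≤ c)
    (hS : 0 < ∑ k, t k ^ p) :
    (c * ∑ k, t k ^ p) ^ (1 / p) * (2 - (∑ k, t k ^ p)⁻¹ * ∑ k, t k ^ p * (t k * a k))
      ≤ (c * ∑ i, s i ^ p) ^ (1 / p) := by
  set S := ∑ k, t k ^ p with hSdef
  set m := S⁻¹ * ∑ k, t k ^ p * (t k * a k) with hm
  have hSm : ∑ k, t k ^ p * (t k * a k) = S * m := by rw [hm]; field_simp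
  have hnn : ∀ k ∈ Finset.univ, 0 ≤ t k ^ p * (t k * a k) := fun k _ => by
    rcases (h.t_nonneg k).eq_or_lt with h0 | hk
    · simp [← h0]
    · have := h.pos_of_pos hk
      positivity
  have hmpos : 0 < m := by
    rw [hm]
    refine mul_pos (inv_pos.2 hS) (lt_of_le_of_ne (Finset.sum_nonneg hnn) fun h0 => ?_)
    have hz := (Finset.sum_eq_zero_iff_of_nonneg hnn).1 h0.symm
    refine hS.ne' (Finset.sum_eq_zero fun k _ => ?_)
    rcases (h.t_nonneg k).eq_or_lt with h0 | hk
    · rw [← h0, Real.zero_rpow hp.ne']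
    · have h1 := h.pos_of_pos hk
      have h2 : 0 < t k ^ p * (t k * a k) := by positivity
      exact absurd (hz k (Finset.mem_univ k)) h2.ne'
  -- The scale `r = m⁻¹` maximizes the lower bound, which then collapses to `m⁻¹ ^ p * S`.
  have hge := h.sum_rpow_ge hp (inv_pos.2 hmpos)
  have e : ∑ k, t k ^ p * (1 + p * (1 - m⁻¹ * (t k * a k))) = S := by
    have : ∀ k, t k ^ p * (1 + p * (1 - m⁻¹ * (t k * a k)))
        = (1 + p) * t k ^ p - p * m⁻¹ * (t k ^ p * (t k * a k)) := fun k => by ring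
    simp_rw [this]
    rw [Finset.sum_sub_distrib, ← Finset.mul_sum, ← Finset.mul_sum, hSm, ← hSdef]
    field_simp
    ring
  rw [e] at hge
  -- The tangent to `m⁻¹` at `m = 1` makes the bound affine in `a`.
  have h2m : 2 - m ≤ m⁻¹ := by
    have : m * m⁻¹ = 1 := mul_inv_cancel₀ hmpos.ne'
    nlinarith [sq_nonneg (m - 1), inv_pos.2 hmpos, mul_nonneg (inv_pos.2 hmpos).le (sq_nonneg (m-1))]
  calc (c * S) ^ (1 / p) * (2 - m) ≤ (c * S) ^ (1 / p) * m⁻¹ := by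
        gcongr
    _ = (c * (m⁻¹ ^ p * S)) ^ (1 / p) := by
        rw [show c * (m⁻¹ ^ p * S) = (c * S) * m⁻¹ ^ p by ring,
          Real.mul_rpow (mul_nonneg hc hS.le) (by positivity), ← Real.rpow_mul (by positivity),
          mul_one_div_cancel hp.ne', Real.rpow_one]
    _ ≤ (c * ∑ i, s i ^ p) ^ (1 / p) := by
        gcongr

lemma Overlap.s_pos (h : Overlap s t a W) (ht : ∀ k, 0 < t k) (i : ι) : 0 < s i := by
  refine lt_of_le_of_ne (h.s_nonneg i) fun h0 => ?_
  have := h.row i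
  rw [Finset.sum_eq_zero fun k _ => by rw [h.eq_zero i k (ht k) h0.symm]; simp] at this
  exact zero_ne_one this

/-- The logarithm of the product of `s` lies above an affine function of `a`. -/
lemma Overlap.sum_log_ge (h : Overlap s t a W) (ht : ∀ k, 0 < t k) :
    ∑ k, Real.log (t k) + ∑ k, (1 - t k * a k) ≤ ∑ i, Real.log (s i) := by
  have e1 : ∑ i, Real.log (s i) = ∑ k, ∑ i, Real.log (s i) * W i k ^ 2 := by
    rw [Finset.sum_comm]
    exact Finset.sum_congr rfl fun i _ => by rw [← Finset.mul_sum, h.row i, mul_one]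
  rw [e1, ← Finset.sum_add_distrib]
  refine Finset.sum_le_sum fun k _ => ?_
  have hk := ht k
  calc Real.log (t k) + (1 - t k * a k)
      ≤ Real.log (t k) + (1 - t k * ∑ i, (s i)⁻¹ * W i k ^ 2) := by
        have := h.sum_inv_le k hk
        gcongr
    _ = ∑ i, (Real.log (t k) + (1 - t k * (s i)⁻¹)) * W i k ^ 2 := by
        have e2 : ∀ i, (Real.log (t k) + (1 - t k * (s i)⁻¹)) * W i k ^ 2
            = (Real.log (t k) + 1) * W i k ^ 2 - t k * ((s i)⁻¹ * W i k ^ 2) := fun i => by ring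
        simp_rw [e2]
        rw [Finset.sum_sub_distrib, ← Finset.mul_sum, ← Finset.mul_sum, h.col k]
        ring
    _ ≤ ∑ i, Real.log (s i) * W i k ^ 2 := by
        refine Finset.sum_le_sum fun i _ => mul_le_mul_of_nonneg_right ?_ (sq_nonneg _)
        have hs := h.s_pos ht i
        have hl := Real.log_le_sub_one_of_pos (mul_pos hk (inv_pos.2 hs))
        rw [Real.log_mul hk.ne' (inv_pos.2 hs).ne', Real.log_inv] at hl
        linarith

/-- Jensen for the concave power `p / N ≤ 1`, column by column; columns outside `T` contribute
nothing. -/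
lemma sum_rpow_le_of_doublyStochastic {s : ι → ℝ} {W : ι → ι → ℝ} {T : Finset ι} {p : ℝ} {N : ℕ}
    (hp : 0 < p) (hN : p ≤ N) (hs : ∀ i, 0 ≤ s i) (row : ∀ i, ∑ k, W i k ^ 2 = 1)
    (col : ∀ k, ∑ i, W i k ^ 2 = 1) (hT : ∀ k ∉ T, ∀ i, s i * W i k ^ 2 = 0) :
    ∑ i, s i ^ p ≤ ∑ k ∈ T, (∑ i, s i ^ N * W i k ^ 2) ^ (p / N) := by
  have hNpos : (0 : ℝ) < N := hp.trans_le hN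
  have e1 : ∑ i, s i ^ p = ∑ k, ∑ i, s i ^ p * W i k ^ 2 := by
    rw [Finset.sum_comm]
    exact Finset.sum_congr rfl fun i _ => by rw [← Finset.mul_sum, row i, mul_one]
  rw [e1, ← Finset.sum_subset (Finset.subset_univ T) (fun k _ hk =>
    Finset.sum_eq_zero fun i _ => ?_)]
  · refine Finset.sum_le_sum fun k _ => ?_
    have hJ := (Real.concaveOn_rpow (p := p / N) (by positivity)
      ((div_le_one hNpos).2 hN)).le_map_sum (t := Finset.univ) (w := fun i => W i k ^ 2)
      (p := fun i => s i ^ N) (fun i _ => sq_nonneg _) (col k)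
      (fun i _ => pow_nonneg (hs i) N)
    simp only [smul_eq_mul] at hJ
    refine le_trans (le_of_eq ?_) (hJ.trans (le_of_eq ?_))
    · refine Finset.sum_congr rfl fun i _ => ?_
      rw [← Real.rpow_natCast (s i) N, ← Real.rpow_mul (hs i), mul_div_cancel₀ _ hNpos.ne', mul_comm]
    · congr 1
      exact Finset.sum_congr rfl fun i _ => mul_comm _ _
  · rcases mul_eq_zero.1 (hT k hk i) with h0 | h0
    · rw [h0, Real.zero_rpow hp.ne', zero_mul]
    · rw [h0, mul_zero]

end Scalar

/-! ### Affine minorants of the criteria. -/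

section Lower

/-- The linear functional `H ↦ ∑ₖ cₖ zₖᵀ H zₖ`. -/
noncomputable def quadSum {ι κ : Type*} [Fintype ι] [Fintype κ] (c : ι → ℝ) (z : ι → κ → ℝ) :
    Matrix κ κ ℝ →ₗ[ℝ] ℝ where
  toFun H := ∑ k, c k * (z k ⬝ᵥ H *ᵥ z k)
  map_add' H K := by
    simp only [add_mulVec, dotProduct_add, mul_add, Finset.sum_add_distrib]
  map_smul' r H := by
    simp only [smul_mulVec, dotProduct_smul, smul_eq_mul, RingHom.id_apply, Finset.mul_sum]
    exact Finset.sum_congr rfl fun k _ => by ring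

variable {ι κ : Type*} [Fintype ι] [DecidableEq ι] [Fintype κ] [DecidableEq κ]

omit [DecidableEq ι] in
lemma posSemidef_covar {A : Matrix κ κ ℝ} (hA : A.PosDef) (B : Matrix ι κ ℝ) :
    (B * A⁻¹ * Bᵀ).PosSemidef := by
  simpa using hA.inv.posSemidef.mul_mul_conjTranspose_same B

lemma overlap_of_spectral {A₀ A : Matrix κ κ ℝ} (hA : A.PosDef)
    {B : Matrix ι κ ℝ} {U V : Matrix ι ι ℝ} {s t : ι → ℝ}
    (hU1 : U * Uᵀ = 1) (hU2 : Uᵀ * U = 1) (ht : ∀ k, 0 ≤ t k)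
    (hF₀ : B * A₀⁻¹ * Bᵀ = U * diagonal t * Uᵀ)
    (hV1 : V * Vᵀ = 1) (hV2 : Vᵀ * V = 1) (hs : ∀ i, 0 ≤ s i)
    (hF : B * A⁻¹ * Bᵀ = V * diagonal s * Vᵀ) :
    Overlap s t (fun k => dualVec A₀ B (Uᵀ k) (t k) ⬝ᵥ A *ᵥ dualVec A₀ B (Uᵀ k) (t k))
      (Vᵀ * U) := by
  have hcol : ∀ k, 0 < t k → B *ᵥ dualVec A₀ B (Uᵀ k) (t k) = Uᵀ k := fun k hk =>
    mulVec_dualVec hk.ne' (by rw [hF₀, spectral_mulVec_col hU2])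
  refine ⟨hs, ht, sum_sq_row_eq_one ?_, sum_sq_col_eq_one ?_, ?_, ?_⟩
  · rw [transpose_mul, transpose_transpose, Matrix.mul_assoc, ← Matrix.mul_assoc U, hU1,
      Matrix.one_mul, hV2]
  · rw [transpose_mul, transpose_transpose, Matrix.mul_assoc, ← Matrix.mul_assoc V, hV1,
      Matrix.one_mul, hU2]
  · intro i k hk hi
    have := overlap_eq_zero hA hV2 hF (dualVec A₀ B (Uᵀ k) (t k)) hi
    rwa [hcol k hk, mulVec_col_eq_mul] at this
  · intro k hk
    have := sum_inv_overlap_le hA hV2 hF (dualVec A₀ B (Uᵀ k) (t k))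
    rwa [hcol k hk] at this

lemma exists_lower_power {p : ℝ} (hp : 0 < p) {c : ℝ} (hc : 0 ≤ c) (B : Matrix ι κ ℝ)
    {A₀ : Matrix κ κ ℝ} (hA₀ : A₀.PosDef)
    (hpos : 0 < (cfc (fun t : ℝ => t ^ p) (B * A₀⁻¹ * Bᵀ)).trace) :
    ∃ ℓ : Matrix κ κ ℝ →ₗ[ℝ] ℝ, ∀ A : Matrix κ κ ℝ, A.PosDef →
      (c * (cfc (fun t : ℝ => t ^ p) (B * A₀⁻¹ * Bᵀ)).trace) ^ (1 / p) + ℓ (A - A₀)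
        ≤ (c * (cfc (fun t : ℝ => t ^ p) (B * A⁻¹ * Bᵀ)).trace) ^ (1 / p) := by
  obtain ⟨U, t, hU1, hU2, ht, hF₀, -, htr₀⟩ := exists_spectral (posSemidef_covar hA₀ B)
  rw [htr₀] at hpos ⊢
  set S := ∑ k, t k ^ p with hS
  set z := fun k => dualVec A₀ B (Uᵀ k) (t k) with hz
  set Φ := (c * S) ^ (1 / p) with hΦ
  -- With these coefficients `ℓ (A - A₀) = Φ * (1 - m)`, where `m` is the weighted mean in
  -- `powerMean_ge` and equals `1` at `A₀`.
  refine ⟨quadSum (fun k => -(Φ * S⁻¹ * t k ^ p * t k)) z, fun A hA => ?_⟩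
  obtain ⟨V, s, hV1, hV2, hs, hF, -, htr⟩ := exists_spectral (posSemidef_covar hA B)
  have hO := overlap_of_spectral hA hU1 hU2 ht hF₀ hV1 hV2 hs hF
  have hge := hO.powerMean_ge hp hc hpos
  rw [htr]
  refine le_trans (le_of_eq ?_) hge
  have hval : ∀ H : Matrix κ κ ℝ, quadSum (fun k => -(Φ * S⁻¹ * t k ^ p * t k)) z H
      = -(Φ * (S⁻¹ * ∑ k, t k ^ p * (t k * (z k ⬝ᵥ H *ᵥ z k)))) := fun H => by
    simp only [quadSum, LinearMap.coe_mk, AddHom.coe_mk, Finset.mul_sum, ← Finset.sum_neg_distrib]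
    exact Finset.sum_congr rfl fun k _ => by ring
  have h₀ : ∑ k, t k ^ p * (t k * (z k ⬝ᵥ A₀ *ᵥ z k)) = S :=
    Finset.sum_congr rfl fun k _ => by
      rcases (ht k).eq_or_lt with h0 | hk
      · rw [← h0, Real.zero_rpow hp.ne', zero_mul]
      · rw [hz, dotProduct_dualVec hA₀ hk.ne' (by rw [hF₀, spectral_mulVec_col hU2])
          (col_dotProduct_self hU2 k), mul_one]
  rw [map_sub, hval, hval, h₀, inv_mul_cancel₀ hpos.ne']
  ring

lemma exists_lower_logDet (B : Matrix ι κ ℝ) {A₀ : Matrix κ κ ℝ} (hA₀ : A₀.PosDef)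
    (hpos : 0 < (B * A₀⁻¹ * Bᵀ).det) :
    ∃ ℓ : Matrix κ κ ℝ →ₗ[ℝ] ℝ, ∀ A : Matrix κ κ ℝ, A.PosDef → 0 < (B * A⁻¹ * Bᵀ).det ∧
      Real.log (B * A₀⁻¹ * Bᵀ).det + ℓ (A - A₀) ≤ Real.log (B * A⁻¹ * Bᵀ).det := by
  obtain ⟨U, t, hU1, hU2, ht, hF₀, hdet₀, -⟩ := exists_spectral (posSemidef_covar hA₀ B)
  rw [hdet₀] at hpos ⊢
  have htpos : ∀ k, 0 < t k := fun k => (ht k).lt_of_ne fun h0 =>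
    hpos.ne' (Finset.prod_eq_zero (Finset.mem_univ k) h0.symm)
  set z := fun k => dualVec A₀ B (Uᵀ k) (t k) with hz
  refine ⟨quadSum (fun k => -t k) z, fun A hA => ?_⟩
  obtain ⟨V, s, hV1, hV2, hs, hF, hdet, -⟩ := exists_spectral (posSemidef_covar hA B)
  have hO := overlap_of_spectral hA hU1 hU2 ht hF₀ hV1 hV2 hs hF
  have hspos := hO.s_pos htpos
  rw [hdet]
  refine ⟨Finset.prod_pos fun i _ => hspos i, ?_⟩
  rw [Real.log_prod fun i _ => (hspos i).ne', Real.log_prod fun i _ => (htpos i).ne']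
  refine le_trans (le_of_eq ?_) (hO.sum_log_ge htpos)
  congr 1
  rw [map_sub]
  simp only [quadSum, LinearMap.coe_mk, AddHom.coe_mk, ← Finset.sum_sub_distrib]
  refine Finset.sum_congr rfl fun k _ => ?_
  have : t k * (z k ⬝ᵥ A₀ *ᵥ z k) = 1 :=
    dotProduct_dualVec hA₀ (htpos k).ne' (by rw [hF₀, spectral_mulVec_col hU2])
      (col_dotProduct_self hU2 k)
  linarith

lemma trace_cfc_rpow_nonneg {F : Matrix ι ι ℝ} (hF : F.PosSemidef) (p : ℝ) :
    0 ≤ (cfc (fun t : ℝ => t ^ p) F).trace := by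
  obtain ⟨V, s, -, -, hs, -, -, htr⟩ := exists_spectral hF
  rw [htr]
  exact Finset.sum_nonneg fun i _ => Real.rpow_nonneg (hs i) p

lemma trace_cfc_pos_of_value_pos {q : ℕ} {p : ℝ} {hp : 0 < p} {F : Matrix (Fin q) (Fin q) ℝ}
    (hF : F.PosSemidef) (h : 0 < (Criterion.power p hp).value F) :
    0 < (q : ℝ)⁻¹ ∧ 0 < (cfc (fun t : ℝ => t ^ p) F).trace := by
  have hne : (q : ℝ)⁻¹ * (cfc (fun t : ℝ => t ^ p) F).trace ≠ 0 := fun h0 => by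
    rw [Criterion.value, h0, Real.zero_rpow (one_div_pos.2 hp).ne'] at h
    exact lt_irrefl _ h
  exact ⟨(inv_nonneg.2 q.cast_nonneg).lt_of_ne' (left_ne_zero_of_mul hne),
    (trace_cfc_rpow_nonneg hF p).lt_of_ne' (right_ne_zero_of_mul hne)⟩

lemma det_pos_of_detRoot_pos {q : ℕ} {F : Matrix (Fin q) (Fin q) ℝ}
    (hF : F.PosSemidef) (h : 0 < Criterion.detRoot.value F) : 0 < F.det := by
  refine hF.det_nonneg.lt_of_ne fun h0 => ?_
  rcases Nat.eq_zero_or_pos q with rfl | hq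
  · simp at h0
  · rw [Criterion.value, ← h0, Real.zero_rpow (by positivity)] at h
    exact lt_irrefl _ h

lemma det_pos_of_logDet_pos {q : ℕ} {F : Matrix (Fin q) (Fin q) ℝ}
    (hF : F.PosSemidef) (h : 0 < Criterion.logDet.value F) : 0 < F.det := by
  refine hF.det_nonneg.lt_of_ne fun h0 => ?_
  rw [Criterion.value, ← h0, Real.log_zero] at h
  exact lt_irrefl _ h

/-- Each criterion has a supporting affine function at a positive definite information matrix. -/
theorem exists_affine_lower (c : Criterion) {q l : ℕ} (B : Matrix (Fin q) (Fin l) ℝ)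
    {A₀ : Matrix (Fin l) (Fin l) ℝ} (hA₀ : A₀.PosDef) (hpos : 0 < c.value (B * A₀⁻¹ * Bᵀ)) :
    ∃ ℓ : Matrix (Fin l) (Fin l) ℝ →ₗ[ℝ] ℝ, ∀ A : Matrix (Fin l) (Fin l) ℝ, A.PosDef →
      c.value (B * A₀⁻¹ * Bᵀ) + ℓ (A - A₀) ≤ c.value (B * A⁻¹ * Bᵀ) := by
  have hF₀ := posSemidef_covar hA₀ B
  cases c with
  | power p hp =>
    obtain ⟨hq, htr⟩ := trace_cfc_pos_of_value_pos hF₀ hpos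
    exact exists_lower_power hp hq.le B hA₀ htr
  | detRoot =>
    have hdet := det_pos_of_detRoot_pos hF₀ hpos
    obtain ⟨ℓ, hℓ⟩ := exists_lower_logDet B hA₀ hdet
    simp only [Criterion.value]
    set r : ℝ := 1 / (q : ℝ) with hr
    have hr0 : 0 ≤ r := by positivity
    -- Chain rule for `det ^ r = exp (r * log det)`.
    refine ⟨((B * A₀⁻¹ * Bᵀ).det ^ r * r) • ℓ, fun A hA => ?_⟩
    obtain ⟨h1, h2⟩ := hℓ A hA
    calc (B * A₀⁻¹ * Bᵀ).det ^ r + (((B * A₀⁻¹ * Bᵀ).det ^ r * r) • ℓ) (A - A₀)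
        = (B * A₀⁻¹ * Bᵀ).det ^ r * (ℓ (A - A₀) * r + 1) := by
          simp only [LinearMap.smul_apply, smul_eq_mul]; ring
      _ ≤ (B * A₀⁻¹ * Bᵀ).det ^ r * Real.exp (ℓ (A - A₀) * r) := by
          have := Real.rpow_nonneg hdet.le r
          gcongr
          exact Real.add_one_le_exp _
      _ = Real.exp ((Real.log (B * A₀⁻¹ * Bᵀ).det + ℓ (A - A₀)) * r) := by
          rw [Real.rpow_def_of_pos hdet, ← Real.exp_add, add_mul]
      _ ≤ (B * A⁻¹ * Bᵀ).det ^ r := by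
          rw [Real.rpow_def_of_pos h1]
          gcongr
  | logDet =>
    obtain ⟨ℓ, hℓ⟩ := exists_lower_logDet B hA₀ (det_pos_of_logDet_pos hF₀ hpos)
    exact ⟨ℓ, fun A hA => (hℓ A hA).2⟩

end Lower

/-! ### Differentiable majorants of the criteria. -/

section Upper

variable {E : Type*} [NormedAddCommGroup E] [NormedSpace ℝ E]
  {ι κ μ : Type*} [Fintype ι] [DecidableEq ι] [Fintype κ] [DecidableEq κ]

/-- All entries of the matrix function are differentiable at the point. -/
def EntryDiff (A : E → Matrix ι κ ℝ) (x : E) : Prop :=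
  ∀ i j, DifferentiableAt ℝ (fun y => A y i j) x

omit [Fintype ι] [DecidableEq ι] [Fintype κ] [DecidableEq κ] in
lemma EntryDiff.const (B : Matrix ι κ ℝ) (x : E) : EntryDiff (fun _ => B) x :=
  fun _ _ => differentiableAt_const _

omit [Fintype ι] [DecidableEq ι] [DecidableEq κ] in
lemma EntryDiff.mul {A : E → Matrix ι κ ℝ} {B : E → Matrix κ μ ℝ} {x : E}
    (hA : EntryDiff A x) (hB : EntryDiff B x) : EntryDiff (fun y => A y * B y) x := fun i j => by
  simp only [Matrix.mul_apply]
  exact DifferentiableAt.fun_sum fun k _ => (hA i k).mul (hB k j)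

lemma EntryDiff.pow {A : E → Matrix ι ι ℝ} {x : E} (hA : EntryDiff A x) (N : ℕ) :
    EntryDiff (fun y => A y ^ N) x := by
  induction N with
  | zero => simpa using EntryDiff.const (E := E) (1 : Matrix ι ι ℝ) x
  | succ N ih => simpa only [pow_succ] using ih.mul hA

lemma EntryDiff.det {A : E → Matrix ι ι ℝ} {x : E} (hA : EntryDiff A x) :
    DifferentiableAt ℝ (fun y => (A y).det) x := by
  simp only [Matrix.det_apply]
  exact DifferentiableAt.fun_sum fun σ _ =>
    DifferentiableAt.const_smul (HasFDerivAt.finsetProd fun i _ =>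
      (hA (σ i) i).hasFDerivAt).differentiableAt (Equiv.Perm.sign σ)

lemma EntryDiff.inv {A : E → Matrix ι ι ℝ} {x : E} (hA : EntryDiff A x) (h : (A x).det ≠ 0) :
    EntryDiff (fun y => (A y)⁻¹) x := fun i j => by
  simp only [Matrix.inv_def, Ring.inverse_eq_inv', Matrix.smul_apply, smul_eq_mul,
    Matrix.adjugate_apply]
  refine (hA.det.inv h).mul (EntryDiff.det fun a b => ?_)
  by_cases hab : a = j
  · subst hab
    simp only [Matrix.updateRow_self]
    exact differentiableAt_const _
  · simp only [Matrix.updateRow_ne hab]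
    exact hA a b

omit [DecidableEq ι] in
lemma EntryDiff.dotProduct {A : E → Matrix ι ι ℝ} {x : E} (hA : EntryDiff A x) (u : ι → ℝ) :
    DifferentiableAt ℝ (fun y => u ⬝ᵥ A y *ᵥ u) x := by
  simp only [_root_.dotProduct, mulVec]
  exact DifferentiableAt.fun_sum fun i _ => (DifferentiableAt.fun_sum fun j _ =>
    (hA i j).mul_const (u j)).const_mul (u i)

lemma spectral_pow {V : Matrix ι ι ℝ} {s : ι → ℝ} (hV1 : V * Vᵀ = 1) (hV2 : Vᵀ * V = 1) (N : ℕ) :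
    (V * diagonal s * Vᵀ) ^ N = V * diagonal (fun i => s i ^ N) * Vᵀ := by
  induction N with
  | zero => simp [hV1]
  | succ N ih =>
    rw [pow_succ, ih]
    calc V * diagonal (fun i => s i ^ N) * Vᵀ * (V * diagonal s * Vᵀ)
        = V * diagonal (fun i => s i ^ N) * (Vᵀ * V) * diagonal s * Vᵀ := by
          simp only [Matrix.mul_assoc]
      _ = V * diagonal (fun i => s i ^ (N + 1)) * Vᵀ := by
          rw [hV2, Matrix.mul_one, Matrix.mul_assoc V, diagonal_mul_diagonal]
          simp only [pow_succ]

/-- The trace of `F ^ p` has a differentiable majorant touching it at a given point. -/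
lemma exists_upper_trace {p : ℝ} (hp : 0 < p) (B : Matrix ι κ ℝ) {A : E → Matrix κ κ ℝ} {x₀ : E}
    (hA : EntryDiff A x₀) (hpd : ∀ᶠ x in 𝓝 x₀, (A x).PosDef) :
    ∃ D : E → ℝ, DifferentiableAt ℝ D x₀ ∧
      D x₀ = (cfc (fun t : ℝ => t ^ p) (B * (A x₀)⁻¹ * Bᵀ)).trace ∧
      ∀ᶠ x in 𝓝 x₀, (cfc (fun t : ℝ => t ^ p) (B * (A x)⁻¹ * Bᵀ)).trace ≤ D x := by
  have hA₀ := hpd.self_of_nhds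
  -- For an integer exponent the entries of `F ^ N` are rational functions of those of `A`.
  obtain ⟨N, hN⟩ := exists_nat_ge p
  have hNpos : (0 : ℝ) < N := hp.trans_le hN
  obtain ⟨U, t, hU1, hU2, ht, hF₀, -, htr₀⟩ := exists_spectral (posSemidef_covar hA₀ B)
  have hdiff : EntryDiff (fun x => (B * (A x)⁻¹ * Bᵀ) ^ N) x₀ :=
    (((EntryDiff.const B x₀).mul (hA.inv hA₀.det_pos.ne')).mul (EntryDiff.const Bᵀ x₀)).pow N
  have hval : ∀ k, Uᵀ k ⬝ᵥ ((B * (A x₀)⁻¹ * Bᵀ) ^ N) *ᵥ Uᵀ k = t k ^ N := fun k => by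
    rw [hF₀, spectral_pow hU1 hU2, spectral_mulVec_col hU2, dotProduct_smul,
      col_dotProduct_self hU2, smul_eq_mul, mul_one]
  -- Null eigenvectors at `x₀` lie in `ker Bᵀ`, so they stay null nearby and can be omitted from the
  -- majorant; the remaining bases `t k ^ N` are positive, where `rpow` is differentiable.
  have hker : ∀ k, t k = 0 → Bᵀ *ᵥ Uᵀ k = 0 := fun k hk => by
    by_contra hne
    have h1 := hA₀.inv.dotProduct_mulVec_pos hne
    have h2 : Uᵀ k ⬝ᵥ (B * (A x₀)⁻¹ * Bᵀ) *ᵥ Uᵀ k = 0 := by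
      rw [hF₀, spectral_mulVec_col hU2, hk, zero_smul, dotProduct_zero]
    rw [star_trivial, mulVec_transpose, ← dotProduct_mulVec, ← mulVec_transpose, mulVec_mulVec,
      mulVec_mulVec, h2] at h1
    exact lt_irrefl _ h1
  refine ⟨fun x => ∑ k with 0 < t k,
    (Uᵀ k ⬝ᵥ ((B * (A x)⁻¹ * Bᵀ) ^ N) *ᵥ Uᵀ k) ^ (p / N), ?_, ?_, ?_⟩
  · refine DifferentiableAt.fun_sum fun k hk => ?_
    refine (hdiff.dotProduct (Uᵀ k)).rpow_const (Or.inl ?_)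
    rw [hval]
    exact (pow_pos (Finset.mem_filter.1 hk).2 N).ne'
  · rw [htr₀, ← Finset.sum_subset (Finset.subset_univ (Finset.univ.filter fun k => 0 < t k))]
    · refine Finset.sum_congr rfl fun k _ => ?_
      rw [hval, ← Real.rpow_natCast (t k) N, ← Real.rpow_mul (ht k), mul_div_cancel₀ _ hNpos.ne']
    · intro k _ hk
      have h0 : t k = 0 := by
        by_contra h
        exact hk (Finset.mem_filter.2 ⟨Finset.mem_univ k, (ht k).lt_of_ne' h⟩)
      rw [h0, Real.zero_rpow hp.ne']
  · filter_upwards [hpd] with x hx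
    obtain ⟨V, s, hV1, hV2, hs, hF, -, htr⟩ := exists_spectral (posSemidef_covar hx B)
    rw [htr]
    have hW1 : (Vᵀ * U) * (Vᵀ * U)ᵀ = 1 := by
      rw [transpose_mul, transpose_transpose, Matrix.mul_assoc, ← Matrix.mul_assoc U, hU1,
        Matrix.one_mul, hV2]
    have hW2 : (Vᵀ * U)ᵀ * (Vᵀ * U) = 1 := by
      rw [transpose_mul, transpose_transpose, Matrix.mul_assoc, ← Matrix.mul_assoc V, hV1,
        Matrix.one_mul, hU2]
    have h := sum_rpow_le_of_doublyStochastic (T := Finset.univ.filter fun k => 0 < t k) hp hN hs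
      (sum_sq_row_eq_one hW1) (sum_sq_col_eq_one hW2) (fun k hk => ?_)
    · refine h.trans (le_of_eq (Finset.sum_congr rfl fun k _ => ?_))
      rw [hF, spectral_pow hV1 hV2, dotProduct_spectral]
      simp only [mulVec_col_eq_mul]
    · have h0 : t k = 0 := by
        by_contra h
        exact hk (Finset.mem_filter.2 ⟨Finset.mem_univ k, (ht k).lt_of_ne' h⟩)
      have h1 : ∑ i, s i * (Vᵀ * U) i k ^ 2 = 0 := by
        have := dotProduct_spectral V s (Uᵀ k)
        rw [← hF, ← mulVec_mulVec, hker k h0, mulVec_zero, dotProduct_zero] at this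
        simpa only [mulVec_col_eq_mul] using this.symm
      intro i
      exact (Finset.sum_eq_zero_iff_of_nonneg fun i _ => mul_nonneg (hs i) (sq_nonneg _)).1 h1 i
        (Finset.mem_univ i)

/-- Each criterion has a differentiable majorant touching it at a given point. -/
theorem exists_upper (c : Criterion) {q l : ℕ} (B : Matrix (Fin q) (Fin l) ℝ)
    {A : E → Matrix (Fin l) (Fin l) ℝ} {x₀ : E} (hA : EntryDiff A x₀)
    (hpd : ∀ᶠ x in 𝓝 x₀, (A x).PosDef) (hpos : 0 < c.value (B * (A x₀)⁻¹ * Bᵀ)) :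
    ∃ D : E → ℝ, DifferentiableAt ℝ D x₀ ∧ D x₀ = c.value (B * (A x₀)⁻¹ * Bᵀ) ∧
      ∀ᶠ x in 𝓝 x₀, c.value (B * (A x)⁻¹ * Bᵀ) ≤ D x := by
  have hA₀ := hpd.self_of_nhds
  have hF₀ := posSemidef_covar hA₀ B
  have hdet : DifferentiableAt ℝ (fun x => (B * (A x)⁻¹ * Bᵀ).det) x₀ :=
    (((EntryDiff.const B x₀).mul (hA.inv hA₀.det_pos.ne')).mul (EntryDiff.const Bᵀ x₀)).det
  cases c with
  | power p hp =>
    obtain ⟨hq, htr⟩ := trace_cfc_pos_of_value_pos hF₀ hpos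
    obtain ⟨D, hD, hD₀, hle⟩ := exists_upper_trace hp B hA hpd
    refine ⟨fun x => ((q : ℝ)⁻¹ * D x) ^ (1 / p),
      (hD.const_mul _).rpow_const (Or.inl ?_), ?_, ?_⟩
    · rw [hD₀]; positivity
    · simp only [hD₀, Criterion.value]
    · filter_upwards [hle, hpd] with x hx hx'
      have := trace_cfc_rpow_nonneg (posSemidef_covar hx' B) p
      simp only [Criterion.value]
      gcongr
  | detRoot =>
    exact ⟨_, hdet.rpow_const (Or.inl (det_pos_of_detRoot_pos hF₀ hpos).ne'), rfl,
      Eventually.of_forall fun x => le_rfl⟩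
  | logDet =>
    exact ⟨_, hdet.log (det_pos_of_logDet_pos hF₀ hpos).ne', rfl,
      Eventually.of_forall fun x => le_rfl⟩

end Upper

/-! ### Differentiability by squeezing. -/

section Sandwich

variable {E : Type*} [NormedAddCommGroup E] [NormedSpace ℝ E]

/-- A function between a touching affine minorant and a touching differentiable majorant is
differentiable. -/
lemma hasFDerivAt_of_sandwich {h D : E → ℝ} {L : E →L[ℝ] ℝ} {x₀ : E}
    (hlow : ∀ᶠ x in 𝓝 x₀, h x₀ + L (x - x₀) ≤ h x) (hD : DifferentiableAt ℝ D x₀)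
    (hD₀ : D x₀ = h x₀) (hup : ∀ᶠ x in 𝓝 x₀, h x ≤ D x) : HasFDerivAt h L x₀ := by
  have hg : HasFDerivAt (fun x => D x - L x) (fderiv ℝ D x₀ - L) x₀ :=
    hD.hasFDerivAt.sub L.hasFDerivAt
  -- `D - L` is minimal at `x₀`, which forces the derivative of `D` to be `L`.
  have hmin : IsLocalMin (fun x => D x - L x) x₀ := by
    filter_upwards [hlow, hup] with x h1 h2
    rw [map_sub] at h1
    linarith
  have hL : fderiv ℝ D x₀ = L := sub_eq_zero.1 (hmin.hasFDerivAt_eq_zero hg)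
  have hD' := hD.hasFDerivAt
  rw [hL, hasFDerivAt_iff_isLittleO] at hD'
  rw [hasFDerivAt_iff_isLittleO]
  refine (Asymptotics.IsBigO.of_bound 1 ?_).trans_isLittleO hD'
  filter_upwards [hlow, hup] with x h1 h2
  rw [one_mul, Real.norm_eq_abs, Real.norm_eq_abs, abs_of_nonneg (by linarith),
    abs_of_nonneg (by linarith)]
  linarith

end Sandwich

/-! ### Openness of positive definiteness. -/

section PosDef

/-- Positivity on the compact unit sphere persists nearby, and homogeneity extends it to all nonzero
vectors. -/
lemma eventually_posDef {E : Type*} [TopologicalSpace E] {κ : Type*} [Fintype κ]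
    {A : E → Matrix κ κ ℝ} {x₀ : E} (hA : Continuous A) (hherm : ∀ x, (A x).IsHermitian)
    (hpd : (A x₀).PosDef) : ∀ᶠ x in 𝓝 x₀, (A x).PosDef := by
  have hcont : Continuous fun y : E × (κ → ℝ) => y.2 ⬝ᵥ A y.1 *ᵥ y.2 :=
    continuous_snd.dotProduct ((hA.comp continuous_fst).matrix_mulVec continuous_snd)
  have h := (isCompact_sphere (0 : κ → ℝ) 1).eventually_forall_of_forall_eventually (x₀ := x₀)
    (P := fun x v => 0 < v ⬝ᵥ A x *ᵥ v) (fun v hv => by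
      refine (hcont.tendsto (x₀, v)).eventually_const_lt ?_
      have hv0 : v ≠ 0 := by
        rintro rfl
        simp at hv
      simpa using hpd.dotProduct_mulVec_pos hv0)
  filter_upwards [h] with x hx
  refine PosDef.of_dotProduct_mulVec_pos (hherm x) fun v hv => ?_
  have hn : 0 < ‖v‖ := norm_pos_iff.2 hv
  have h1 := hx (‖v‖⁻¹ • v) (by simp [norm_smul, hn.ne'])
  rw [mulVec_smul, dotProduct_smul, smul_dotProduct, smul_eq_mul, smul_eq_mul, ← mul_assoc] at h1
  rw [star_trivial]
  exact pos_of_mul_pos_right h1 (by positivity)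

end PosDef

/-! ### Information matrices and criteria as functions of the weights. -/

variable {d : ℕ} {Ω : Set (Fin d → ℝ)} {n : ℕ}

lemma GLM.weight_nonneg (M : GLM Ω) (x : Fin d → ℝ) : 0 ≤ M.weight x :=
  inv_nonneg.2 (mul_nonneg (ProbabilityTheory.variance_nonneg _ _) (sq_nonneg _))

lemma GLM.info_designOf (M : GLM Ω) (x : Fin n → Fin d → ℝ) (lam : Fin n → ℝ) :
    M.info (designOf x lam)
      = ∑ i, (lam i * M.weight (x i)) • vecMulVec (M.basis (x i)) (M.basis (x i)) := by
  rw [GLM.info, designOf, ← Finsupp.sum_finsetSum_index (by simp)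
    (fun a b₁ b₂ => by rw [add_mul, add_smul])]
  exact Finset.sum_congr rfl fun i _ => Finsupp.sum_single_index (by simp)

/-- The information matrix as a linear function of the weights. -/
noncomputable def GLM.infoMap (M : GLM Ω) (x : Fin n → Fin d → ℝ) :
    (Fin n → ℝ) →ₗ[ℝ] Matrix (Fin M.numBasis) (Fin M.numBasis) ℝ where
  toFun lam := M.info (designOf x lam)
  map_add' a b := by
    simp only [GLM.info_designOf, Pi.add_apply, add_mul, add_smul, Finset.sum_add_distrib]
  map_smul' r a := by
    simp only [GLM.info_designOf, Pi.smul_apply, smul_eq_mul, RingHom.id_apply, Finset.smul_sum,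
      smul_smul, mul_assoc]

lemma GLM.infoMap_apply (M : GLM Ω) (x : Fin n → Fin d → ℝ) (lam : Fin n → ℝ) :
    M.infoMap x lam = M.info (designOf x lam) := rfl

lemma GLM.entryDiff_infoMap (M : GLM Ω) (x : Fin n → Fin d → ℝ) (lam : Fin n → ℝ) :
    EntryDiff (M.infoMap x) lam := fun i j =>
  (LinearMap.toContinuousLinearMap
    ((Matrix.entryLinearMap ℝ ℝ i j).comp (M.infoMap x))).differentiableAt

lemma GLM.continuous_infoMap (M : GLM Ω) (x : Fin n → Fin d → ℝ) :
    Continuous (M.infoMap x) :=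
  continuous_matrix fun i j => (LinearMap.toContinuousLinearMap
    ((Matrix.entryLinearMap ℝ ℝ i j).comp (M.infoMap x))).continuous

lemma GLM.isHermitian_infoMap (M : GLM Ω) (x : Fin n → Fin d → ℝ) (lam : Fin n → ℝ) :
    (M.infoMap x lam).IsHermitian := by
  rw [Matrix.IsHermitian, conjTranspose_eq_transpose_of_trivial, infoMap_apply, info_designOf,
    transpose_sum]
  exact Finset.sum_congr rfl fun i _ => by rw [transpose_smul, transpose_vecMulVec]

lemma GLM.posDef_infoMap (M : GLM Ω) (x : Fin n → Fin d → ℝ) {lam : Fin n → ℝ}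
    (hlam : ∀ i, 0 ≤ lam i) (h : M.Nonsingular (designOf x lam)) : (M.infoMap x lam).PosDef := by
  have hps : (M.infoMap x lam).PosSemidef := by
    rw [infoMap_apply, info_designOf]
    exact posSemidef_sum _ fun i _ => PosSemidef.smul
      (by simpa using posSemidef_vecMulVec_self_star (M.basis (x i)))
      (mul_nonneg (hlam i) (M.weight_nonneg _))
  exact hps.posDef_iff_isUnit.2 ((Matrix.isUnit_iff_isUnit_det _).2 h)

lemma isDesign_designOf {x : Fin n → Fin d → ℝ} (hx : ∀ i, x i ∈ Ω) {lam : Fin n → ℝ}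
    (h : lam ∈ stdSimplex ℝ (Fin n)) : IsDesign Ω (designOf x lam) := by
  classical
  refine ⟨fun y => ?_, ?_, fun y hy => ?_⟩
  · rw [designOf, Finsupp.finsetSum_apply]
    refine Finset.sum_nonneg fun i _ => ?_
    rw [Finsupp.single_apply]
    split_ifs
    exacts [h.1 i, le_rfl]
  · rw [designOf, ← Finsupp.sum_finsetSum_index (fun _ => rfl) (fun _ _ _ => rfl)]
    simpa using h.2
  · by_contra hn
    refine (Finsupp.mem_support_iff.1 hy) ?_
    rw [designOf, Finsupp.finsetSum_apply]
    refine Finset.sum_eq_zero fun i _ => Finsupp.single_eq_of_ne ?_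
    rintro rfl
    exact hn (hx i)

lemma designOf_segment (x : Fin n → Fin d → ℝ) (lam : Fin n → ℝ) (i : Fin n) (α : ℝ) :
    (1 - α) • designOf x lam + α • Finsupp.single (x i) 1
      = designOf x (lam + α • (Pi.single i 1 - lam)) := by
  have h1 : ∀ a b : Fin n → ℝ, designOf x (a + b) = designOf x a + designOf x b := fun a b => by
    simp [designOf, Finsupp.single_add, Finset.sum_add_distrib]
  have h2 : ∀ (r : ℝ) (a : Fin n → ℝ), designOf x (r • a) = r • designOf x a := fun r a => by
    simp [designOf, Finset.smul_sum]
  have h3 : designOf x (Pi.single i 1) = Finsupp.single (x i) 1 := by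
    rw [designOf, Finset.sum_eq_single i (fun j _ hj => by simp [hj]) (by simp)]
    simp
  rw [← h3, ← h2, ← h2, ← h1]
  congr 1
  ext k
  simp
  ring

/-- The derivative is taken in all of `ℝⁿ`: positive definiteness is open, so nearby vectors outside
the simplex cause no trouble. -/
lemma GLM.exists_hasFDerivAt_Phi (M : GLM Ω) (c : Criterion) {q : ℕ}
    (f : (Fin M.numBasis → ℝ) → Fin q → ℝ) (x : Fin n → Fin d → ℝ) {lam : Fin n → ℝ}
    (hpd : (M.infoMap x lam).PosDef) (hpos : 0 < M.Phi c f (designOf x lam)) :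
    ∃ L : (Fin n → ℝ) →L[ℝ] ℝ, HasFDerivAt (fun ν => M.Phi c f (designOf x ν)) L lam ∧
      ∀ ν, (M.infoMap x ν).PosDef →
        M.Phi c f (designOf x lam) + L (ν - lam) ≤ M.Phi c f (designOf x ν) := by
  have hev := eventually_posDef (M.continuous_infoMap x) (M.isHermitian_infoMap x) hpd
  obtain ⟨ℓ, hℓ⟩ := exists_affine_lower c (jacobian f M.coef) hpd hpos
  obtain ⟨D, hD, hD₀, hup⟩ := exists_upper c (jacobian f M.coef) (M.entryDiff_infoMap x lam) hev
    hpos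
  have hlow : ∀ ν, (M.infoMap x ν).PosDef → M.Phi c f (designOf x lam)
      + LinearMap.toContinuousLinearMap (ℓ.comp (M.infoMap x)) (ν - lam)
        ≤ M.Phi c f (designOf x ν) := fun ν hν => by
    simpa only [LinearMap.coe_toContinuousLinearMap', LinearMap.comp_apply, map_sub] using! hℓ _ hν
  exact ⟨_, hasFDerivAt_of_sandwich (hev.mono hlow) hD hD₀ hup, hlow⟩

/-! ### Differentiability and tangent bound for `se`. -/

section Criteria

variable {m : ℕ} (c : Criterion) (M : Fin m → GLM Ω) {q : Fin m → ℕ}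
  (f : ∀ j, (Fin (M j).numBasis → ℝ) → Fin (q j) → ℝ) (ξopt : Fin m → (Fin d → ℝ) →₀ ℝ)

lemma se_eq (ξ : (Fin d → ℝ) →₀ ℝ) :
    se c M f ξopt ξ = ∑ j, Real.exp (((M j).Phi c (f j) (ξopt j))⁻¹ * (M j).Phi c (f j) ξ) :=
  Finset.sum_congr rfl fun j _ => by rw [GLM.eff, one_div_div, div_eq_inv_mul]

variable {c M f ξopt}

/-- At an admissible weight vector `se` is differentiable in the weights, and lies above its
tangent on the admissible weight vectors. -/
lemma exists_hasFDerivAt_se (hopt : ∀ j, (M j).IsLocalOptimal c (f j) (ξopt j))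
    (hpos : ∀ j, 0 < (M j).Phi c (f j) (ξopt j)) {x : Fin n → Fin d → ℝ} (hx : ∀ i, x i ∈ Ω)
    {lam : Fin n → ℝ} (hlam : lam ∈ weightDomain M x) :
    ∃ L : (Fin n → ℝ) →L[ℝ] ℝ, HasFDerivAt (fun ν => se c M f ξopt (designOf x ν)) L lam ∧
      ∀ ν ∈ weightDomain M x,
        se c M f ξopt (designOf x lam) + L (ν - lam) ≤ se c M f ξopt (designOf x ν) := by
  have hj : ∀ j, ∃ L : (Fin n → ℝ) →L[ℝ] ℝ,
      HasFDerivAt (fun ν => (M j).Phi c (f j) (designOf x ν)) L lam ∧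
      ∀ ν, ((M j).infoMap x ν).PosDef → (M j).Phi c (f j) (designOf x lam) + L (ν - lam)
        ≤ (M j).Phi c (f j) (designOf x ν) := fun j =>
    (M j).exists_hasFDerivAt_Phi c (f j) x ((M j).posDef_infoMap x hlam.1.1 (hlam.2 j))
      -- Optimality of `ξopt j` carries positivity of the criterion over to `lam`.
      ((hpos j).trans_le ((hopt j).2 _ (isDesign_designOf hx hlam.1) (hlam.2 j)))
  choose L hL hle using hj
  simp only [se_eq]
  refine ⟨_, HasFDerivAt.fun_sum fun j _ => ((hL j).const_mul _).exp, fun ν hν => ?_⟩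
  rw [_root_.sum_apply, ← Finset.sum_add_distrib]
  refine Finset.sum_le_sum fun j _ => ?_
  have h := hle j ν ((M j).posDef_infoMap x hν.1.1 (hν.2 j))
  set r := ((M j).Phi c (f j) (ξopt j))⁻¹
  have hr : 0 ≤ r := (inv_pos.2 (hpos j)).le
  set a := (M j).Phi c (f j) (designOf x lam)
  calc Real.exp (r * a) + (Real.exp (r * a) • r • L j) (ν - lam)
      = Real.exp (r * a) * (r * L j (ν - lam) + 1) := by
        simp only [_root_.smul_apply, smul_eq_mul]; ring
    _ ≤ Real.exp (r * a) * Real.exp (r * L j (ν - lam)) := by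
        gcongr
        exact Real.add_one_le_exp _
    _ = Real.exp (r * (a + L j (ν - lam))) := by rw [← Real.exp_add, mul_add]
    _ ≤ Real.exp (r * (M j).Phi c (f j) (designOf x ν)) := by gcongr

lemma tendsto_seQuotient {x : Fin n → Fin d → ℝ} {lam : Fin n → ℝ} {L : (Fin n → ℝ) →L[ℝ] ℝ}
    (hL : HasFDerivAt (fun ν => se c M f ξopt (designOf x ν)) L lam) (i : Fin n) :
    Tendsto (seQuotient c M f ξopt (Finsupp.single (x i) 1) (designOf x lam)) (𝓝[>] (0 : ℝ))
      (𝓝 (L (Pi.single i 1 - lam))) := by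
  have h := (hL.hasLineDerivAt (Pi.single i 1 - lam)).tendsto_slope_zero_right
  refine h.congr fun α => ?_
  rw [seQuotient, designOf_segment, smul_eq_mul, div_eq_inv_mul]

/-- A vertex may itself be inadmissible, but short moves towards it are: invertibility is open and
the simplex convex. -/
lemma eventually_mem_weightDomain {x : Fin n → Fin d → ℝ} {lam : Fin n → ℝ}
    (hlam : lam ∈ weightDomain M x) (i : Fin n) :
    ∀ᶠ α in 𝓝[>] (0 : ℝ), lam + α • (Pi.single i 1 - lam) ∈ weightDomain M x := by
  have hcont : Continuous fun α : ℝ => lam + α • (Pi.single i 1 - lam) := by fun_prop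
  have hns : ∀ᶠ α in 𝓝[>] (0 : ℝ), ∀ j,
      (M j).Nonsingular (designOf x (lam + α • (Pi.single i 1 - lam))) := by
    refine eventually_all.2 fun j => nhdsWithin_le_nhds ?_
    have h1 : Continuous fun α : ℝ =>
        ((M j).infoMap x (lam + α • (Pi.single i 1 - lam))).det :=
      (((M j).continuous_infoMap x).comp hcont).matrix_det
    have h2 := h1.continuousAt.eventually_ne (x := (0 : ℝ)) (y := 0)
      (by simpa [GLM.infoMap_apply] using (hlam.2 j).ne_zero)
    exact h2.mono fun α hα => hα.isUnit
  filter_upwards [hns, self_mem_nhdsWithin, nhdsWithin_le_nhds (eventually_lt_nhds one_pos)]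
    with α h1 h2 h3
  refine ⟨?_, h1⟩
  have h2' : (0 : ℝ) < α := h2
  have := (convex_stdSimplex ℝ (Fin n)) hlam.1 (single_mem_stdSimplex ℝ i)
    (sub_nonneg.2 h3.le) h2'.le (by ring)
  convert this using 1
  ext k
  simp
  ring

end Criteria

end MmPhi

/-! ### The optimality conditions. -/

theorem corollary1 {d : ℕ} {Ω : Set (Fin d → ℝ)} {m n : ℕ} (c : MmPhi.Criterion)
    (M : Fin m → MmPhi.GLM Ω) {q : Fin m → ℕ}
    (f : ∀ j, (Fin (M j).numBasis → ℝ) → Fin (q j) → ℝ)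
    (hf : ∀ j, DifferentiableAt ℝ (f j) (M j).coef)
    (ξopt : Fin m → (Fin d → ℝ) →₀ ℝ)
    (hopt : ∀ j, (M j).IsLocalOptimal c (f j) (ξopt j))
    (hpos : ∀ j, 0 < (M j).Phi c (f j) (ξopt j))
    (x : Fin n → Fin d → ℝ) (hx : ∀ i, x i ∈ Ω)
    (lam : Fin n → ℝ) (hlam : lam ∈ MmPhi.weightDomain M x) :
    (∀ i, Tendsto
      (MmPhi.seQuotient c M f ξopt (Finsupp.single (x i) 1) (MmPhi.designOf x lam))
      (𝓝[>] (0 : ℝ))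
      (𝓝 (MmPhi.pointDirDeriv c M f ξopt (x i) (MmPhi.designOf x lam)))) ∧
    List.TFAE [
      IsMinOn (fun lam' => MmPhi.se c M f ξopt (MmPhi.designOf x lam'))
        (MmPhi.weightDomain M x) lam,
      IsMinOn (fun lam' => MmPhi.lse c M f ξopt (MmPhi.designOf x lam'))
        (MmPhi.weightDomain M x) lam,
      ∀ i, (0 < lam i →
          MmPhi.pointDirDeriv c M f ξopt (x i) (MmPhi.designOf x lam) = 0) ∧
        (lam i = 0 →
          0 ≤ MmPhi.pointDirDeriv c M f ξopt (x i) (MmPhi.designOf x lam))] := by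
  obtain ⟨L, hL, htangent⟩ := MmPhi.exists_hasFDerivAt_se hopt hpos hx hlam
  have htends := fun i => MmPhi.tendsto_seQuotient hL i
  have hφ : ∀ i, MmPhi.pointDirDeriv c M f ξopt (x i) (MmPhi.designOf x lam)
      = L (Pi.single i 1 - lam) := fun i => (htends i).limUnder_eq
  -- Uses that the weights sum to one. At `ν = lam` it says that the `lam`-average of the
  -- directional derivatives is zero.
  have hdecomp : ∀ ν ∈ stdSimplex ℝ (Fin n),
      L (ν - lam) = ∑ i, ν i * L (Pi.single i 1 - lam) := fun ν hν => by
    simp only [map_sub, mul_sub, Finset.sum_sub_distrib]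
    rw [← Finset.sum_mul, hν.2, one_mul]
    have hsum : ν = ∑ i, ν i • (Pi.single i 1 : Fin n → ℝ) := by
      ext k
      simp [Finset.sum_apply, Pi.single_apply]
    conv_lhs => rw [hsum]
    simp only [map_sum, map_smul, smul_eq_mul]
  simp only [hφ]
  refine ⟨htends, ?_⟩
  tfae_have 1 ↔ 2 := by
    simp only [isMinOn_iff]
    refine forall₂_congr fun ν _ => ?_
    -- Without models `se = 0` lies outside the domain of monotonicity of `log`, but both functions
    -- are constant.
    rcases isEmpty_or_nonempty (Fin m) with hm | hm
    · simp [MmPhi.se, MmPhi.lse]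
    · exact (Real.log_le_log_iff
        (Finset.sum_pos (fun j _ => Real.exp_pos _) Finset.univ_nonempty)
        (Finset.sum_pos (fun j _ => Real.exp_pos _) Finset.univ_nonempty)).symm
  tfae_have 1 → 3 := by
    intro hmin
    have hnn : ∀ i, 0 ≤ L (Pi.single i 1 - lam) := fun i => by
      refine ge_of_tendsto (htends i) ?_
      filter_upwards [MmPhi.eventually_mem_weightDomain hlam i, self_mem_nhdsWithin] with α h1 h2
      rw [MmPhi.seQuotient, MmPhi.designOf_segment]
      exact div_nonneg (sub_nonneg.2 (isMinOn_iff.1 hmin _ h1)) (le_of_lt h2)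
    have hsum := hdecomp lam hlam.1
    rw [sub_self, map_zero] at hsum
    have hz := (Finset.sum_eq_zero_iff_of_nonneg fun i _ =>
      mul_nonneg (hlam.1.1 i) (hnn i)).1 hsum.symm
    exact fun i => ⟨fun hi => (mul_eq_zero.1 (hz i (Finset.mem_univ i))).resolve_left hi.ne',
      fun _ => hnn i⟩
  tfae_have 3 → 1 := by
    intro h
    refine isMinOn_iff.2 fun ν hν => ?_
    have hnn : 0 ≤ L (ν - lam) := by
      rw [hdecomp ν hν.1]
      refine Finset.sum_nonneg fun i _ => mul_nonneg (hν.1.1 i) ?_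
      rcases (hlam.1.1 i).eq_or_lt with h0 | h0
      exacts [(h i).2 h0.symm, ((h i).1 h0).ge]
    linarith [htangent ν hν]
  tfae_finish
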